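/- A 3-graph $H$ consists of a finite vertex set $V$ and a set of 3-element subsets of $V$, called edges. A set $S\subseteq V$ is homogeneous if either every 3-element subset of $S$ is an edge of $H$, or no 3-element subset of $S$ is an edge of $H$; let $h(H)$ be the size of a largest homogeneous set of $H$. For a set $Q$ of pairs of non-negative integers, $H$ is called $Q$-free if for every $(m,f)\in Q$ no $m$-element set of vertices of $H$ contains exactly $f$ edges of $H$. Let $h_3(n,Q)$ denote the minimum of $h(H)$ over all $Q$-free 3-graphs $H$ on $n$ vertices. **Theorem.** Let $n\ge 4$ be an integer. Then $$h_3(n,\{(4,0),(4,2),(4,3)\})=n-1$$ and $$h_3(n,\{(4,0),(4,1),(4,3)\})=\begin{cases}\dfrac n2 & \text{if } n\equiv 0 \pmod 6,\\[2mm] \left\lceil\dfrac{n+1}{2}\right\rceil & \text{if } n\not\equiv 0\pmod 6.\end{cases}$$ -/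

import Mathlib

/-- An `r`-graph (`r`-uniform hypergraph) on the finite vertex set `V`:
a set of edges, each of which is an `r`-element set of vertices. -/
structure RGraph (r : ℕ) (V : Type*) [Fintype V] [DecidableEq V] where
  edges : Finset (Finset V)
  uniform : ∀ e ∈ edges, e.card = r

namespace RGraph

variable {r : ℕ} {V : Type*} [Fintype V] [DecidableEq V]

/-- The edges of the subgraph of `H` induced by the vertex set `S`. -/
def inducedEdges (H : RGraph r V) (S : Finset V) : Finset (Finset V) :=
  H.edges.filter (fun e => e ⊆ S)

/-- `H` is `(m, f)`-free: no `m` vertices of `H` induce a subgraph with exactly `f` edges. -/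
def IsPairFree (H : RGraph r V) (p : ℕ × ℕ) : Prop :=
  ∀ S : Finset V, S.card = p.1 → (H.inducedEdges S).card ≠ p.2

/-- `H` is `Q`-free: it is `(m, f)`-free for every order-size pair `(m, f)` in `Q`. -/
def IsFree (H : RGraph r V) (Q : Set (ℕ × ℕ)) : Prop :=
  ∀ p ∈ Q, H.IsPairFree p

/-- `S` is a clique: every `r`-subset of `S` is an edge. -/
def IsClique (H : RGraph r V) (S : Finset V) : Prop :=
  ∀ e : Finset V, e ⊆ S → e.card = r → e ∈ H.edges

/-- `S` is a coclique (independent set): no `r`-subset of `S` is an edge. -/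
def IsCoclique (H : RGraph r V) (S : Finset V) : Prop :=
  ∀ e : Finset V, e ⊆ S → e.card = r → e ∉ H.edges

/-- A homogeneous set is a set of vertices that is a clique or a coclique. -/
def IsHomogeneous (H : RGraph r V) (S : Finset V) : Prop :=
  H.IsClique S ∨ H.IsCoclique S

open Classical in
/-- `h(H)`, the size of a largest homogeneous set of `H`. -/
noncomputable def homNumber (H : RGraph r V) : ℕ :=
  (Finset.univ.filter (fun S : Finset V => H.IsHomogeneous S)).sup Finset.card

end RGraph

/-- `h_r(n, Q)`: the minimum of `h(H)` over all `Q`-free `r`-graphs `H` on `n` vertices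
(it is attained as soon as one such `H` exists; by convention `sInf ∅ = 0`). -/
noncomputable def minHomNumber (r n : ℕ) (Q : Set (ℕ × ℕ)) : ℕ :=
  sInf {k : ℕ | ∃ H : RGraph r (Fin n), H.IsFree Q ∧ H.homNumber = k}

/-! For the first value every 4-set spans 1 or 4 edges. If some triple is a non-edge, a 4-set
containing it has a single edge, and the vertex off that edge turns out to lie in no edge at all.
All other triples are then edges, since a 4-set through that vertex must span one. Conversely, a
complete 3-graph plus an isolated vertex is extremal.

For the second value every 4-set spans 2 or 4 edges, so the non-edges form a two-graph. Fix `v` and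
let `Γ` be the link of `v` in the non-edges: a triple is a non-edge iff it spans an odd number of
`Γ`-edges. Excluding (4,0) makes `Γ` triangle-free and without induced 2K₂. So either `Γ` is
bipartite, and its two sides, each with `v` added, are cliques of total size n+1; or `Γ` is a
blow-up of C₅ plus isolated vertices (`exists_pentagon_or_bipartition`, `exists_pentagonAdj_hom`).
In the latter case ten triples of the six classes yield cliques, and averaging gives n/2, with
equality only for equal classes. Balanced blow-ups attain the bound. -/

namespace RGraph

/-! ### Homogeneous sets and edge counts on four vertices -/

section Basic

variable {r : ℕ} {V : Type*} [Fintype V] [DecidableEq V]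

lemma card_le_homNumber {H : RGraph r V} {S : Finset V} (hS : H.IsHomogeneous S) :
    S.card ≤ H.homNumber := by
  classical
  unfold homNumber
  exact Finset.le_sup (f := Finset.card) (by simpa using hS)

lemma homNumber_le {H : RGraph r V} {k : ℕ} (h : ∀ S, H.IsHomogeneous S → S.card ≤ k) :
    H.homNumber ≤ k := by
  classical
  unfold homNumber
  exact Finset.sup_le fun S hS => h S (by simpa using hS)

lemma card_inducedEdges_of_card_eq_succ (H : RGraph r V) {S : Finset V} (hS : S.card = r + 1) :
    (H.inducedEdges S).card = ∑ x ∈ S, if S.erase x ∈ H.edges then 1 else 0 := by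
  rw [← Finset.card_filter]
  symm
  refine Finset.card_bij (fun x _ => S.erase x) ?_ ?_ ?_
  · intro x hx
    rw [Finset.mem_filter] at hx
    exact Finset.mem_filter.2 ⟨hx.2, Finset.erase_subset _ _⟩
  · intro x hx y hy hxy
    rw [Finset.mem_filter] at hx hy
    by_contra hne
    have : x ∈ S.erase y := Finset.mem_erase.2 ⟨hne, hx.1⟩
    rw [← hxy] at this
    simp at this
  · intro e he
    obtain ⟨he, hsub⟩ := Finset.mem_filter.1 he
    have hc : (S \ e).card = 1 := by
      rw [Finset.card_sdiff_of_subset hsub, hS, H.uniform e he]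
      omega
    obtain ⟨x, hx⟩ := Finset.card_eq_one.1 hc
    have hex : S.erase x = e := by
      rw [← Finset.sdiff_singleton_eq_erase, ← hx, Finset.sdiff_sdiff_eq_self hsub]
    have hxS : x ∈ S := (Finset.mem_sdiff.1 (hx ▸ Finset.mem_singleton_self x)).1
    exact ⟨x, Finset.mem_filter.2 ⟨hxS, hex ▸ he⟩, hex⟩

lemma card_inducedEdges_four (H : RGraph 3 V) {a b c d : V} (hab : a ≠ b) (hac : a ≠ c)
    (had : a ≠ d) (hbc : b ≠ c) (hbd : b ≠ d) (hcd : c ≠ d) :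
    (H.inducedEdges {a, b, c, d}).card =
      (if {b, c, d} ∈ H.edges then 1 else 0) + (if {a, c, d} ∈ H.edges then 1 else 0) +
      (if {a, b, d} ∈ H.edges then 1 else 0) + (if {a, b, c} ∈ H.edges then 1 else 0) := by
  have hS : ({a, b, c, d} : Finset V).card = 3 + 1 := by
    simp [*]
  have ha : ({a, b, c, d} : Finset V).erase a = {b, c, d} := by ext; simp; grind
  have hb : ({a, b, c, d} : Finset V).erase b = {a, c, d} := by ext; simp; grind
  have hc : ({a, b, c, d} : Finset V).erase c = {a, b, d} := by ext; simp; grind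
  have hd : ({a, b, c, d} : Finset V).erase d = {a, b, c} := by ext; simp; grind
  rw [H.card_inducedEdges_of_card_eq_succ hS, Finset.sum_insert (by simp [*]),
    Finset.sum_insert (by simp [*]), Finset.sum_insert (by simp [*]), Finset.sum_singleton,
    ha, hb, hc, hd]
  ring

lemma isPairFree_four_iff (H : RGraph 3 V) (f : ℕ) :
    H.IsPairFree (4, f) ↔ ∀ a b c d : V, a ≠ b → a ≠ c → a ≠ d → b ≠ c → b ≠ d → c ≠ d →
      (if {b, c, d} ∈ H.edges then 1 else 0) + (if {a, c, d} ∈ H.edges then 1 else 0) +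
      (if {a, b, d} ∈ H.edges then 1 else 0) + (if {a, b, c} ∈ H.edges then 1 else 0) ≠ f := by
  constructor
  · intro h a b c d hab hac had hbc hbd hcd
    rw [← H.card_inducedEdges_four hab hac had hbc hbd hcd]
    exact h _ (by simp [*])
  · intro h S hS
    obtain ⟨a, T, haT, rfl, hT⟩ := Finset.card_eq_succ.1 (show S.card = 3 + 1 from hS)
    obtain ⟨b, c, d, hbc, hbd, hcd, rfl⟩ := Finset.card_eq_three.1 hT
    simp only [Finset.mem_insert, Finset.mem_singleton, not_or] at haT
    rw [H.card_inducedEdges_four haT.1 haT.2.1 haT.2.2 hbc hbd hcd]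
    exact h a b c d haT.1 haT.2.1 haT.2.2 hbc hbd hcd

lemma isClique_three_iff (H : RGraph 3 V) (S : Finset V) :
    H.IsClique S ↔ ∀ x ∈ S, ∀ y ∈ S, ∀ z ∈ S, x ≠ y → x ≠ z → y ≠ z → {x, y, z} ∈ H.edges := by
  constructor
  · intro h x hx y hy z hz hxy hxz hyz
    exact h _ (by simp [Finset.insert_subset_iff, *]) (by simp [*])
  · intro h e he hc
    obtain ⟨x, y, z, hxy, hxz, hyz, rfl⟩ := Finset.card_eq_three.1 hc
    simp only [Finset.insert_subset_iff, Finset.singleton_subset_iff] at he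
    exact h x he.1 y he.2.1 z he.2.2 hxy hxz hyz

end Basic

lemma minHomNumber_eq {r n k : ℕ} {Q : Set (ℕ × ℕ)}
    (hex : ∃ H : RGraph r (Fin n), H.IsFree Q ∧ H.homNumber ≤ k)
    (hle : ∀ H : RGraph r (Fin n), H.IsFree Q → k ≤ H.homNumber) : minHomNumber r n Q = k := by
  obtain ⟨H, hH, hk⟩ := hex
  have hmem : H.homNumber ∈ {k : ℕ | ∃ H : RGraph r (Fin n), H.IsFree Q ∧ H.homNumber = k} :=
    ⟨H, hH, rfl⟩
  unfold minHomNumber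
  apply le_antisymm
  · exact (Nat.sInf_le hmem).trans hk
  · refine le_csInf ⟨_, hmem⟩ ?_
    rintro _ ⟨H', hH', rfl⟩
    exact hle H' hH'

/-! ### 4-sets with 1 or 4 edges -/

section Star

variable {V : Type*} [Fintype V] [DecidableEq V]

/-- The complete 3-graph on the vertices other than `v`. -/
def completeAvoiding (v : V) : RGraph 3 V where
  edges := Finset.univ.filter fun e => e.card = 3 ∧ v ∉ e
  uniform e he := by simp_all

lemma completeAvoiding_isFree (v : V) :
    (completeAvoiding v).IsFree {(4, 0), (4, 2), (4, 3)} := by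
  have key : ∀ a b c d : V, a ≠ b → a ≠ c → a ≠ d → b ≠ c → b ≠ d → c ≠ d →
      (if {b, c, d} ∈ (completeAvoiding v).edges then 1 else 0) +
      (if {a, c, d} ∈ (completeAvoiding v).edges then 1 else 0) +
      (if {a, b, d} ∈ (completeAvoiding v).edges then 1 else 0) +
      (if {a, b, c} ∈ (completeAvoiding v).edges then 1 else 0) ∈ ({1, 4} : Set ℕ) := by
    intro a b c d hab hac had hbc hbd hcd
    simp only [completeAvoiding, Finset.mem_filter, Finset.mem_univ, true_and]
    rw [Finset.card_eq_three.2 ⟨b, c, d, hbc, hbd, hcd, rfl⟩,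
      Finset.card_eq_three.2 ⟨a, c, d, hac, had, hcd, rfl⟩,
      Finset.card_eq_three.2 ⟨a, b, d, hab, had, hbd, rfl⟩,
      Finset.card_eq_three.2 ⟨a, b, c, hab, hac, hbc, rfl⟩]
    simp only [Finset.mem_insert, Finset.mem_singleton, true_and, not_or, Set.mem_insert_iff,
      Set.mem_singleton_iff]
    by_cases ha : v = a
    · subst ha; simp [*]
    by_cases hb : v = b
    · subst hb; simp [*]
    by_cases hc : v = c
    · subst hc; simp [*]
    by_cases hd : v = d
    · subst hd; simp [*]
    simp [*]
  rintro _ (rfl | rfl | rfl) <;> rw [isPairFree_four_iff] <;>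
    intro a b c d hab hac had hbc hbd hcd heq <;>
    have := key a b c d hab hac had hbc hbd hcd <;>
    rw [heq] at this <;> simp at this

lemma completeAvoiding_homNumber_le (v : V) (hV : 4 ≤ Fintype.card V) :
    (completeAvoiding v).homNumber ≤ Fintype.card V - 1 := by
  apply homNumber_le
  intro S hS
  by_contra! hlt
  have hSu : S = Finset.univ := by
    rw [← Finset.card_eq_iff_eq_univ]
    have := S.card_le_univ
    omega
  subst hSu
  rcases hS with h | h
  · obtain ⟨e, hve, -, he⟩ := Finset.exists_subsuperset_card_eq (s := {v}) (t := Finset.univ)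
      (n := 3) (by simp) (by simp) (by rw [Finset.card_univ]; omega)
    have := h e (Finset.subset_univ _) he
    simp_all [completeAvoiding]
  · obtain ⟨e, hve, he⟩ := Finset.exists_subset_card_eq (s := Finset.univ.erase v)
      (n := 3) (by rw [Finset.card_erase_of_mem (Finset.mem_univ _), Finset.card_univ]; omega)
    refine h e (Finset.subset_univ _) he ?_
    simp only [completeAvoiding, Finset.mem_filter, Finset.mem_univ, true_and]
    exact ⟨he, fun hv => by simpa using hve hv⟩

lemma le_homNumber_of_isFree_star (hV : 4 ≤ Fintype.card V) (H : RGraph 3 V)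
    (hH : H.IsFree {(4, 0), (4, 2), (4, 3)}) : Fintype.card V - 1 ≤ H.homNumber := by
  have h0 := (H.isPairFree_four_iff 0).1 (hH (4, 0) (by simp))
  have h2 := (H.isPairFree_four_iff 2).1 (hH (4, 2) (by simp))
  have h3 := (H.isPairFree_four_iff 3).1 (hH (4, 3) (by simp))
  by_cases hcl : H.IsClique Finset.univ
  · have := card_le_homNumber (Or.inl hcl : H.IsHomogeneous _)
    rw [Finset.card_univ] at this
    omega
  suffices h : ∃ a, H.IsClique (Finset.univ.erase a) by
    obtain ⟨a, ha⟩ := h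
    have := card_le_homNumber (Or.inl ha : H.IsHomogeneous _)
    rwa [Finset.card_erase_of_mem (Finset.mem_univ _), Finset.card_univ] at this
  obtain ⟨T, hT⟩ : ∃ T : V → V → V → Prop, ∀ x y z, {x, y, z} ∈ H.edges ↔ T x y z :=
    ⟨_, fun _ _ _ => Iff.rfl⟩
  have s1 : ∀ x y z, T x y z ↔ T y x z := fun x y z => by
    rw [← hT, ← hT, Finset.insert_comm]
  have s2 : ∀ x y z, T x y z ↔ T x z y := fun x y z => by
    rw [← hT, ← hT, Finset.pair_comm]
  have key : ∀ a b c d : V, a ≠ b → a ≠ c → a ≠ d → b ≠ c → b ≠ d → c ≠ d →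
      (T a b c ∧ T a b d ∧ T a c d ∧ T b c d) ∨ (T a b c ∧ ¬ T a b d ∧ ¬ T a c d ∧ ¬ T b c d) ∨
      (¬ T a b c ∧ T a b d ∧ ¬ T a c d ∧ ¬ T b c d) ∨
      (¬ T a b c ∧ ¬ T a b d ∧ T a c d ∧ ¬ T b c d) ∨
      (¬ T a b c ∧ ¬ T a b d ∧ ¬ T a c d ∧ T b c d) := by
    intro a b c d hab hac had hbc hbd hcd
    have h0 := h0 a b c d hab hac had hbc hbd hcd
    have h2 := h2 a b c d hab hac had hbc hbd hcd
    have h3 := h3 a b c d hab hac had hbc hbd hcd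
    clear hcl
    simp only [← hT]
    by_cases p : {b, c, d} ∈ H.edges <;> by_cases q : {a, b, d} ∈ H.edges <;>
      by_cases s : {a, c, d} ∈ H.edges <;> by_cases t : {a, b, c} ∈ H.edges <;>
      simp [p, q, s, t] at h0 h2 h3 ⊢
  -- An isolated vertex `a` of a 4-set stays isolated when `x` is added. If `abx` were an edge, the
  -- 4-sets `abcx`, `abdx` would exclude `acx`, `adx`, `bcx`, `bdx`; then `acdx` forces `cdx`, and
  -- `bcdx` has exactly two edges.
  have five : ∀ a b c d x : V, a ≠ b → a ≠ c → a ≠ d → b ≠ c → b ≠ d → c ≠ d →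
      x ≠ a → x ≠ b → x ≠ c → x ≠ d → ¬ T a b c → ¬ T a b d → ¬ T a c d → T b c d →
      ¬ T a b x ∧ ¬ T a c x ∧ ¬ T a d x ∧ T b c x := by
    intro a b c d x hab hac had hbc hbd hcd hxa hxb hxc hxd n1 n2 n3 t
    have k1 := key a b c x hab hac hxa.symm hbc hxb.symm hxc.symm
    have k2 := key a b d x hab had hxa.symm hbd hxb.symm hxd.symm
    have k3 := key a c d x hac had hxa.symm hcd hxc.symm hxd.symm
    have k4 := key b c d x hbc hbd hxb.symm hcd hxc.symm hxd.symm
    clear key h0 h2 h3 hT s1 s2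
    grind
  rw [isClique_three_iff] at hcl
  push Not at hcl
  obtain ⟨a₀, -, b₀, -, c₀, -, hab₀, hac₀, hbc₀, hn₀⟩ := hcl
  rw [hT] at hn₀
  obtain ⟨d, hd⟩ : ∃ d, d ∉ ({a₀, b₀, c₀} : Finset V) := by
    by_contra! hall
    have h1 := Finset.card_le_card (fun x _ => hall x : Finset.univ ⊆ _)
    have h2 := Finset.card_le_three (a := a₀) (b := b₀) (c := c₀)
    rw [Finset.card_univ] at h1
    omega
  simp only [Finset.mem_insert, Finset.mem_singleton, not_or] at hd
  obtain ⟨a, b, c, hab, hac, hbc, had, hbd, hcd, n1, n2, n3, t⟩ : ∃ a b c, a ≠ b ∧ a ≠ c ∧ b ≠ c ∧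
      a ≠ d ∧ b ≠ d ∧ c ≠ d ∧ ¬ T a b c ∧ ¬ T a b d ∧ ¬ T a c d ∧ T b c d := by
    obtain ⟨ha, hb, hc⟩ := hd
    rcases key a₀ b₀ c₀ d hab₀ hac₀ (Ne.symm ha) hbc₀ (Ne.symm hb) (Ne.symm hc) with
      h | h | h | h | h
    · exact absurd h.1 hn₀
    · exact absurd h.1 hn₀
    · refine ⟨c₀, a₀, b₀, hac₀.symm, hbc₀.symm, hab₀, Ne.symm hc, Ne.symm ha, Ne.symm hb, ?_, ?_,
        ?_, h.2.1⟩
      · rw [s1, s2]; exact hn₀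
      · rw [s1]; exact h.2.2.1
      · rw [s1]; exact h.2.2.2
    · refine ⟨b₀, a₀, c₀, hab₀.symm, hbc₀, hac₀, Ne.symm hb, Ne.symm ha, Ne.symm hc, ?_, ?_, ?_,
        h.2.2.1⟩
      · rw [s1]; exact hn₀
      · rw [s1]; exact h.2.1
      · exact h.2.2.2
    · exact ⟨a₀, b₀, c₀, hab₀, hac₀, hbc₀, Ne.symm ha, Ne.symm hb, Ne.symm hc, hn₀, h.2.1,
        h.2.2.1, h.2.2.2⟩
  have star : ∀ x, x ≠ a → x ≠ b → x ≠ c → ¬ T a b x ∧ ¬ T a c x ∧ T b c x := by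
    intro x hxa hxb hxc
    by_cases hxd : x = d
    · subst hxd; exact ⟨n2, n3, t⟩
    · have := five a b c d x hab hac had hbc hbd hcd hxa hxb hxc hxd n1 n2 n3 t
      exact ⟨this.1, this.2.1, this.2.2.2⟩
  have pair : ∀ x y, x ≠ a → y ≠ a → x ≠ y → ¬ T a x y := by
    intro x y hxa hya hxy
    by_cases hxb : x = b
    · subst hxb
      by_cases hyc : y = c
      · subst hyc; exact n1
      · exact (star y hya hxy.symm hyc).1
    by_cases hxc : x = c
    · subst hxc
      by_cases hyb : y = b
      · subst hyb; rwa [s2]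
      · exact (star y hya hyb hxy.symm).2.1
    have hx := star x hxa hxb hxc
    by_cases hyb : y = b
    · subst hyb; rw [s2]; exact hx.1
    by_cases hyc : y = c
    · subst hyc; rw [s2]; exact hx.2.1
    exact (five a b c x y hab hac (Ne.symm hxa) hbc (Ne.symm hxb) (Ne.symm hxc) hya hyb hyc
      hxy.symm n1 hx.1 hx.2.1 hx.2.2).2.2.1
  refine ⟨a, (H.isClique_three_iff _).2 ?_⟩
  intro x hx y hy z hz hxy hxz hyz
  rw [hT]
  have hx := Finset.ne_of_mem_erase hx
  have hy := Finset.ne_of_mem_erase hy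
  have hz := Finset.ne_of_mem_erase hz
  have p1 := pair x y hx hy hxy
  have p2 := pair x z hx hz hxz
  have p3 := pair y z hy hz hyz
  have := key a x y z hx.symm hy.symm hz.symm hxy hxz hyz
  tauto

end Star

/-! ### Upper bound: balanced blow-ups of the pentagon with an isolated vertex -/

section Pentagon

/-- Adjacency in the graph on six vertices made of a 5-cycle and an isolated vertex. -/
def pentagonAdj (i j : Fin 6) : Bool :=
  decide (i.val < 5 ∧ j.val < 5 ∧ ((i.val + 1) % 5 = j.val ∨ (j.val + 1) % 5 = i.val))

/-- Three vertices span an odd number of edges of the 5-cycle with an isolated vertex. -/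
def pentagonOdd (i j k : Fin 6) : Bool :=
  (pentagonAdj i j).xor ((pentagonAdj j k).xor (pentagonAdj i k))

variable {V : Type*} [Fintype V] [DecidableEq V]

/-- The blow-up, along `f`, of the complement of the two-graph of the 5-cycle with an
isolated vertex. -/
def pentagonBlowup (f : V → Fin 6) : RGraph 3 V where
  edges := Finset.univ.filter fun e => e.card = 3 ∧
    4 ∣ ∑ x ∈ e, ∑ y ∈ e, (pentagonAdj (f x) (f y)).toNat
  uniform e he := by simp_all

lemma mem_pentagonBlowup_edges (f : V → Fin 6) {x y z : V} (hxy : x ≠ y) (hxz : x ≠ z)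
    (hyz : y ≠ z) :
    {x, y, z} ∈ (pentagonBlowup f).edges ↔ pentagonOdd (f x) (f y) (f z) = false := by
  simp only [pentagonBlowup, Finset.mem_filter, Finset.mem_univ, true_and]
  rw [Finset.card_eq_three.2 ⟨x, y, z, hxy, hxz, hyz, rfl⟩]
  have h : ∀ g : V → ℕ, ∑ a ∈ {x, y, z}, g a = g x + (g y + g z) := by
    intro g
    rw [Finset.sum_insert (by simp [*]), Finset.sum_insert (by simp [*]), Finset.sum_singleton]
  simp only [h, true_and]
  generalize f x = i
  generalize f y = j
  generalize f z = k
  revert i j k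
  decide

lemma pentagonBlowup_isFree (f : V → Fin 6) :
    (pentagonBlowup f).IsFree {(4, 0), (4, 1), (4, 3)} := by
  have dec : ∀ i j k l : Fin 6, (pentagonOdd j k l).toNat + (pentagonOdd i k l).toNat +
      (pentagonOdd i j l).toNat + (pentagonOdd i j k).toNat = 0 ∨
      (pentagonOdd j k l).toNat + (pentagonOdd i k l).toNat +
      (pentagonOdd i j l).toNat + (pentagonOdd i j k).toNat = 2 := by decide
  have ite_eq : ∀ b : Bool, (if b = false then 1 else 0) = 1 - b.toNat := by decide
  have le_one : ∀ b : Bool, b.toNat ≤ 1 := by decide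
  have key : ∀ a b c d : V, a ≠ b → a ≠ c → a ≠ d → b ≠ c → b ≠ d → c ≠ d →
      ∀ m ∈ ({0, 1, 3} : Set ℕ), (if {b, c, d} ∈ (pentagonBlowup f).edges then 1 else 0) +
      (if {a, c, d} ∈ (pentagonBlowup f).edges then 1 else 0) +
      (if {a, b, d} ∈ (pentagonBlowup f).edges then 1 else 0) +
      (if {a, b, c} ∈ (pentagonBlowup f).edges then 1 else 0) ≠ m := by
    intro a b c d hab hac had hbc hbd hcd m hm
    simp only [mem_pentagonBlowup_edges f hab hac hbc, mem_pentagonBlowup_edges f hab had hbd,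
      mem_pentagonBlowup_edges f hac had hcd, mem_pentagonBlowup_edges f hbc hbd hcd, ite_eq]
    have := dec (f a) (f b) (f c) (f d)
    have h1 := le_one (pentagonOdd (f b) (f c) (f d))
    have h2 := le_one (pentagonOdd (f a) (f c) (f d))
    have h3 := le_one (pentagonOdd (f a) (f b) (f d))
    have h4 := le_one (pentagonOdd (f a) (f b) (f c))
    rcases hm with rfl | rfl | rfl <;> omega
  rintro _ (rfl | rfl | rfl) <;> rw [isPairFree_four_iff] <;>
    intro a b c d hab hac had hbc hbd hcd <;>
    exact key a b c d hab hac had hbc hbd hcd _ (by simp)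

lemma card_le_three_of_isCoclique {H : RGraph 3 V} (hH : H.IsPairFree (4, 0)) {S : Finset V}
    (hS : H.IsCoclique S) : S.card ≤ 3 := by
  by_contra! hlt
  obtain ⟨T, hTS, hT⟩ := Finset.exists_subset_card_eq (show 4 ≤ S.card from hlt)
  refine hH T hT (Finset.card_eq_zero.2 (Finset.filter_eq_empty_iff.2 fun e he heT => ?_))
  exact hS e (heT.trans hTS) (H.uniform e he) he

/-- A relabelling of the six vertices after which the first three span an odd number of edges. -/
def pentagonRelabel : Fin 6 → Fin 6 := ![0, 1, 3, 2, 4, 5]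

/-- With n = 6q + r, the first r classes have one extra vertex. The bound r / 2 + 1 has content
beyond `T.card ≤ 3` and the trivial bound r only for r = 0 and r = 3; the latter is why the
relabelling makes the first three classes odd. -/
lemma card_le_of_pentagonRelabel_even : ∀ T : Finset (Fin 6),
    (∀ i ∈ T, ∀ j ∈ T, ∀ k ∈ T, i ≠ j → i ≠ k → j ≠ k →
      pentagonOdd (pentagonRelabel i) (pentagonRelabel j) (pentagonRelabel k) = false) →
    T.card ≤ 3 ∧ ∀ r < 6, (T.filter fun t => t.val < r).card ≤ if r = 0 then 0 else r / 2 + 1 := by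
  decide +kernel

lemma exists_isFree_homNumber_le (n : ℕ) (hn : 4 ≤ n) :
    ∃ H : RGraph 3 (Fin n), H.IsFree {(4, 0), (4, 1), (4, 3)} ∧
      H.homNumber ≤ if n % 6 = 0 then n / 2 else n / 2 + 1 := by
  let g : Fin n → Fin 6 := fun x => ⟨x.val % 6, Nat.mod_lt _ (by norm_num)⟩
  have hfree := pentagonBlowup_isFree (fun x => pentagonRelabel (g x))
  refine ⟨_, hfree, homNumber_le fun S hS => ?_⟩
  rcases hS with hS | hS
  · rw [isClique_three_iff] at hS
    obtain ⟨hT, hr⟩ := card_le_of_pentagonRelabel_even (S.image g) (by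
      simp only [Finset.mem_image, forall_exists_index, and_imp]
      rintro _ x hx rfl _ y hy rfl _ z hz rfl hxy hxz hyz
      have hxy : x ≠ y := fun h => hxy (h ▸ rfl)
      have hxz : x ≠ z := fun h => hxz (h ▸ rfl)
      have hyz : y ≠ z := fun h => hyz (h ▸ rfl)
      exact (mem_pentagonBlowup_edges _ hxy hxz hyz).1 (hS x hx y hy z hz hxy hxz hyz))
    have hr := hr (n % 6) (Nat.mod_lt _ (by norm_num))
    have hfib : ∀ t ∈ S.image g, (S.filter fun x => g x = t).card ≤
        n / 6 + if t.val < n % 6 then 1 else 0 := by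
      intro t _
      rw [← Finset.card_range (n / 6 + _)]
      apply Finset.card_le_card_of_injOn (fun x => x.val / 6)
      · intro x hx
        have hx := (Finset.mem_filter.1 (Finset.mem_coe.1 hx)).2
        have hx : x.val % 6 = t.val := congrArg Fin.val hx
        have := x.isLt
        simp only [Finset.coe_range, Set.mem_Iio]
        split_ifs <;> omega
      · intro x hx y hy hxy
        have hx := (Finset.mem_filter.1 (Finset.mem_coe.1 hx)).2
        have hx : x.val % 6 = t.val := congrArg Fin.val hx
        have hy := (Finset.mem_filter.1 (Finset.mem_coe.1 hy)).2
        have hy : y.val % 6 = t.val := congrArg Fin.val hy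
        have hxy : x.val / 6 = y.val / 6 := hxy
        apply Fin.ext
        omega
    have hsum := (Finset.card_eq_sum_card_image g S).trans_le (Finset.sum_le_sum hfib)
    rw [Finset.sum_add_distrib, Finset.sum_const, smul_eq_mul, ← Finset.card_filter] at hsum
    have := Nat.mul_le_mul_right (n / 6) hT
    split_ifs at hr ⊢ <;> omega
  · have := card_le_three_of_isCoclique (hfree (4, 0) (by simp)) hS
    split_ifs <;> omega

end Pentagon

/-! ### Triangle-free graphs without induced 2K₂ -/

section Structure

variable {V : Type*} {Γ : SimpleGraph V}

/-- Fix an edge `ab`. A closed 5-walk through it is an induced 5-cycle, by triangle-freeness. If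
there is none, the graph is coloured by its position relative to `ab`; every edge has an end
adjacent to `a` or `b`, which determines both colours. -/
lemma exists_pentagon_or_bipartition
    (htri : ∀ x y z, Γ.Adj x y → Γ.Adj y z → ¬ Γ.Adj x z)
    (hind : ∀ a b c d, Γ.Adj a b → Γ.Adj c d →
      Γ.Adj a c ∨ Γ.Adj a d ∨ Γ.Adj b c ∨ Γ.Adj b d) :
    (∃ c : Fin 5 → V, ∀ i j, Γ.Adj (c i) (c j) ↔ pentagonAdj i.castSucc j.castSucc = true) ∨
    ∃ p : V → Prop, ∀ x y, Γ.Adj x y → (p x ↔ ¬ p y) := by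
  by_cases hE : ∃ a b, Γ.Adj a b
  swap
  · push Not at hE
    exact Or.inr ⟨fun _ => True, fun x y h => absurd h (hE x y)⟩
  obtain ⟨a, b, hab⟩ := hE
  by_cases hC : ∃ x r y, Γ.Adj a x ∧ Γ.Adj x r ∧ Γ.Adj r y ∧ Γ.Adj y b
  · obtain ⟨x, r, y, hax, hxr, hry, hyb⟩ := hC
    left
    have n1 : ¬ Γ.Adj a r := htri _ _ _ hax hxr
    have n2 : ¬ Γ.Adj x y := htri _ _ _ hxr hry
    have n3 : ¬ Γ.Adj r b := htri _ _ _ hry hyb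
    have n4 : ¬ Γ.Adj a y := fun h => htri _ _ _ h hyb hab
    have n5 : ¬ Γ.Adj x b := htri _ _ _ hax.symm hab
    refine ⟨![a, x, r, y, b], fun i j => ?_⟩
    have m1 := mt SimpleGraph.Adj.symm n1
    have m2 := mt SimpleGraph.Adj.symm n2
    have m3 := mt SimpleGraph.Adj.symm n3
    have m4 := mt SimpleGraph.Adj.symm n4
    have m5 := mt SimpleGraph.Adj.symm n5
    have := hab.symm
    have := hax.symm
    have := hxr.symm
    have := hry.symm
    have := hyb.symm
    fin_cases i <;> fin_cases j <;> simp [pentagonAdj, *]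
  · right
    refine ⟨fun x => Γ.Adj x b ∨ (¬ Γ.Adj x a ∧ ∃ y, Γ.Adj x y ∧ Γ.Adj y a), fun x y h => ?_⟩
    have hQ : ∀ u w, Γ.Adj u w → Γ.Adj u b → ¬ ∃ y, Γ.Adj w y ∧ Γ.Adj y a := by
      rintro u w huw hub ⟨y, hwy, hya⟩
      exact hC ⟨y, w, u, hya.symm, hwy.symm, huw.symm, hub⟩
    have hQ' : ∀ u w, Γ.Adj u w → Γ.Adj u a → ∃ y, Γ.Adj w y ∧ Γ.Adj y a :=
      fun u w huw hua => ⟨u, huw.symm, hua⟩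
    have h1 := hind x y a b h hab
    have h2 := hQ x y h
    have h3 := hQ y x h.symm
    have h4 := hQ' x y h
    have h5 := hQ' y x h.symm
    have h7 : Γ.Adj x a → Γ.Adj y a → False := fun h' h'' => htri _ _ _ h'.symm h h''.symm
    have h8 : Γ.Adj x b → Γ.Adj y b → False := fun h' h'' => htri _ _ _ h'.symm h h''.symm
    have h9 : Γ.Adj x a → Γ.Adj x b → False := fun h' h'' => htri _ _ _ h'.symm h'' hab
    have h10 : Γ.Adj y a → Γ.Adj y b → False := fun h' h'' => htri _ _ _ h'.symm h'' hab
    clear hQ hQ' htri hind hC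
    beta_reduce
    generalize (∃ z, Γ.Adj x z ∧ Γ.Adj z a) = qx at *
    generalize (∃ z, Γ.Adj y z ∧ Γ.Adj z a) = qy at *
    grind

/-- The neighbours of a vertex on the cycle are independent and cannot be a single vertex, as the
opposite cycle edge would give an induced 2K₂. They are thus empty or the neighbourhood of a cycle
vertex, which defines the class. -/
lemma exists_pentagonAdj_hom {c : Fin 5 → V}
    (hc : ∀ i j, Γ.Adj (c i) (c j) ↔ pentagonAdj i.castSucc j.castSucc = true)
    (htri : ∀ x y z, Γ.Adj x y → Γ.Adj y z → ¬ Γ.Adj x z)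
    (hind : ∀ a b c d, Γ.Adj a b → Γ.Adj c d →
      Γ.Adj a c ∨ Γ.Adj a d ∨ Γ.Adj b c ∨ Γ.Adj b d) :
    ∃ φ : V → Fin 6, ∀ x y, Γ.Adj x y ↔ pentagonAdj (φ x) (φ y) = true := by
  classical
  have dec₁ : ∀ N : Fin 5 → Bool,
      -- `N` is the trace of a vertex on the cycle.
      (∀ k l, N k = true → N l = true → pentagonAdj k.castSucc l.castSucc = false) →
      (∀ k l m, N k = true → pentagonAdj l.castSucc m.castSucc = true →
        N l = true ∨ N m = true ∨ pentagonAdj k.castSucc l.castSucc = true ∨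
        pentagonAdj k.castSucc m.castSucc = true) →
      ∃ i, ∀ k, N k = pentagonAdj i k.castSucc := by
    decide +kernel
  -- Adjacent vertices in non-adjacent classes would create a triangle, or a 2K₂ with a cycle edge
  -- that both miss.
  have dec₂ : ∀ i j, pentagonAdj i j = false →
      (∃ k : Fin 5, pentagonAdj i k.castSucc = true ∧ pentagonAdj j k.castSucc = true) ∨
      ∃ k l : Fin 5, pentagonAdj k.castSucc l.castSucc = true ∧
        pentagonAdj i k.castSucc = false ∧ pentagonAdj i l.castSucc = false ∧
        pentagonAdj j k.castSucc = false ∧ pentagonAdj j l.castSucc = false := by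
    decide +kernel
  -- For adjacent classes, the edges to `k` and `l` can only be joined by the edge between the two
  -- vertices themselves.
  have dec₃ : ∀ i j, pentagonAdj i j = true →
      ∃ k l : Fin 5, pentagonAdj i k.castSucc = true ∧ pentagonAdj j l.castSucc = true ∧
        pentagonAdj k.castSucc l.castSucc = false ∧ pentagonAdj i l.castSucc = false ∧
        pentagonAdj j k.castSucc = false := by
    decide +kernel
  have hφ : ∀ x, ∃ i, ∀ k, Γ.Adj x (c k) ↔ pentagonAdj i k.castSucc = true := by
    intro x
    obtain ⟨i, hi⟩ := dec₁ (fun k => decide (Γ.Adj x (c k)))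
      (by
        intro k l hk hl
        simp only [decide_eq_true_eq] at hk hl
        rw [← Bool.not_eq_true, ← hc]
        exact htri _ _ _ hk.symm hl)
      (by
        intro k l m hk hlm
        simp only [decide_eq_true_eq] at hk ⊢
        rw [← hc] at hlm
        rw [← hc, ← hc]
        exact (hind _ _ _ _ hk hlm))
    exact ⟨i, fun k => by rw [← hi k, decide_eq_true_eq]⟩
  choose φ hφ using hφ
  refine ⟨φ, fun x y => ⟨fun h => ?_, fun h => ?_⟩⟩
  · by_contra hn
    rw [Bool.not_eq_true] at hn
    rcases dec₂ _ _ hn with ⟨k, hk, hk'⟩ | ⟨k, l, hkl, h1, h2, h3, h4⟩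
    · exact htri _ _ _ h ((hφ y k).2 hk') ((hφ x k).2 hk)
    · rw [← hc] at hkl
      rw [← Bool.not_eq_true, ← hφ] at h1 h2 h3 h4
      have := hind _ _ _ _ h hkl
      tauto
  · obtain ⟨k, l, hk, hl, hkl, h1, h2⟩ := dec₃ _ _ h
    rw [← hφ] at hk hl
    rw [← Bool.not_eq_true, ← hφ] at h1 h2
    rw [← Bool.not_eq_true, ← hc] at hkl
    have := hind _ _ _ _ hk hl
    have s := Γ.adj_comm (c k) y
    tauto

end Structure

/-! ### Lower bound when 4-sets span 2 or 4 edges -/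

section LowerBound

variable {V : Type*} [Fintype V] [DecidableEq V]

/-- For a 3-graph whose 4-sets all span 2 or 4 edges, the nonadjacency in the link of `v`. -/
def colinkGraph (H : RGraph 3 V) (v : V) : SimpleGraph V where
  Adj x y := x ≠ y ∧ x ≠ v ∧ y ≠ v ∧ {v, x, y} ∉ H.edges
  symm := ⟨fun x y h => ⟨h.1.symm, h.2.2.1, h.2.1, by rw [Finset.pair_comm]; exact h.2.2.2⟩⟩
  loopless := ⟨fun x h => h.1 rfl⟩

lemma le_homNumber_of_isFree_even [Nonempty V] (H : RGraph 3 V)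
    (hH : H.IsFree {(4, 0), (4, 1), (4, 3)}) :
    (if Fintype.card V % 6 = 0 then Fintype.card V / 2 else Fintype.card V / 2 + 1) ≤
      H.homNumber := by
  have h0 := (H.isPairFree_four_iff 0).1 (hH (4, 0) (by simp))
  have h1 := (H.isPairFree_four_iff 1).1 (hH (4, 1) (by simp))
  have h3 := (H.isPairFree_four_iff 3).1 (hH (4, 3) (by simp))
  obtain ⟨v⟩ := ‹Nonempty V›
  let Γ := H.colinkGraph v
  have hΓ : ∀ x y, Γ.Adj x y ↔ x ≠ y ∧ x ≠ v ∧ y ≠ v ∧ {v, x, y} ∉ H.edges :=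
    fun _ _ => Iff.rfl
  have hv : ∀ y, ¬ Γ.Adj v y := fun y h => h.2.1 rfl
  have hv' : ∀ y, ¬ Γ.Adj y v := fun y h => h.2.2.1 rfl
  -- The nested equivalence holds exactly when an odd number of the three adjacencies hold.
  have hodd : ∀ x y z, x ≠ y → x ≠ z → y ≠ z →
      ({x, y, z} ∈ H.edges ↔ ¬ (Γ.Adj x y ↔ (Γ.Adj y z ↔ Γ.Adj x z))) := by
    intro x y z hxy hxz hyz
    by_cases hx : x = v
    · subst hx
      have := hΓ y z
      simp only [hv, false_iff, iff_false]
      rw [this]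
      simp [hyz, hxy.symm, hxz.symm]
    by_cases hy : y = v
    · subst hy
      have := hΓ x z
      simp only [hv, hv', false_iff]
      rw [this, Finset.insert_comm]
      simp [hxz, hxy, hyz.symm]
    by_cases hz : z = v
    · subst hz
      have := hΓ x y
      have hperm : ({x, y, z} : Finset V) = {z, x, y} := by ext; simp; tauto
      simp only [hv', iff_true]
      rw [this, hperm]
      simp [hxy, hxz, hyz]
    have k0 := h0 v x y z (Ne.symm hx) (Ne.symm hy) (Ne.symm hz) hxy hxz hyz
    have k1 := h1 v x y z (Ne.symm hx) (Ne.symm hy) (Ne.symm hz) hxy hxz hyz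
    have k3 := h3 v x y z (Ne.symm hx) (Ne.symm hy) (Ne.symm hz) hxy hxz hyz
    simp only [hΓ, hx, hy, hz, hxy, hxz, hyz, ne_eq, not_false_eq_true, true_and]
    by_cases p : {x, y, z} ∈ H.edges <;> by_cases q : {v, y, z} ∈ H.edges <;>
      by_cases s : {v, x, z} ∈ H.edges <;> by_cases t : {v, x, y} ∈ H.edges <;>
      simp [p, q, s, t] at k0 k1 k3 ⊢
  have htri : ∀ x y z, Γ.Adj x y → Γ.Adj y z → ¬ Γ.Adj x z := by
    intro x y z hxy hyz hxz
    have k0 := h0 v x y z hxy.2.1.symm hxy.2.2.1.symm hyz.2.2.1.symm hxy.1 hxz.1 hyz.1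
    have k1 := h1 v x y z hxy.2.1.symm hxy.2.2.1.symm hyz.2.2.1.symm hxy.1 hxz.1 hyz.1
    simp only [hxy.2.2.2, hyz.2.2.2, hxz.2.2.2, if_false] at k0 k1
    split_ifs at k0 k1 <;> omega
  have hind : ∀ a b c d, Γ.Adj a b → Γ.Adj c d →
      Γ.Adj a c ∨ Γ.Adj a d ∨ Γ.Adj b c ∨ Γ.Adj b d := by
    intro a b c d hab hcd
    by_contra! hn
    obtain ⟨n1, n2, n3, n4⟩ := hn
    have hac : a ≠ c := fun h => n2 (h ▸ hcd)
    have had : a ≠ d := fun h => n1 (h ▸ hcd.symm)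
    have hbc : b ≠ c := fun h => n1 (h ▸ hab)
    have hbd : b ≠ d := fun h => n2 (h ▸ hab)
    apply h0 a b c d hab.ne hac had hbc hbd hcd.ne
    simp [hodd, hab.ne, hac, had, hbc, hbd, hcd.ne, hab, hcd, n1, n2, n3, n4]
  have hclique : ∀ S : Finset V, (∀ x ∈ S, ∀ y ∈ S, ∀ z ∈ S,
      ¬ (Γ.Adj x y ↔ (Γ.Adj y z ↔ Γ.Adj x z))) → S.card ≤ H.homNumber := by
    intro S hS
    refine card_le_homNumber (Or.inl ((H.isClique_three_iff S).2 ?_))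
    intro x hx y hy z hz hxy hxz hyz
    exact (hodd x y z hxy hxz hyz).2 (hS x hx y hy z hz)
  rcases exists_pentagon_or_bipartition htri hind with ⟨c, hc⟩ | ⟨p, hp⟩
  · obtain ⟨φ, hφ⟩ := exists_pentagonAdj_hom hc htri hind
    have block : ∀ T : Finset (Fin 6),
        (∀ i ∈ T, ∀ j ∈ T, ∀ k ∈ T, pentagonOdd i j k = false) →
        ∑ t ∈ T, (Finset.univ.filter fun x => φ x = t).card ≤ H.homNumber := by
      intro T hT
      rw [Finset.sum_card_fiberwise_eq_card_filter]
      apply hclique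
      simp only [Finset.mem_filter, Finset.mem_univ, true_and]
      intro x hx y hy z hz
      have := hT _ hx _ hy _ hz
      rw [hφ, hφ, hφ]
      revert this
      unfold pentagonOdd
      generalize pentagonAdj (φ x) (φ y) = b₁
      generalize pentagonAdj (φ y) (φ z) = b₂
      generalize pentagonAdj (φ x) (φ z) = b₃
      revert b₁ b₂ b₃
      decide
    have htot : ∑ t, (Finset.univ.filter fun x => φ x = t).card = Fintype.card V := by
      rw [Finset.sum_card_fiberwise_eq_card_filter]
      simp
    -- These ten triples form a 2-(6,3,2) design: each class lies in five, so their sizes sum to 5n.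
    -- If all are at most n/2, all equal n/2, which forces six equal classes and 6 ∣ n.
    have b0 := block {0, 1, 2} (by decide)
    have b1 := block {1, 2, 3} (by decide)
    have b2 := block {2, 3, 4} (by decide)
    have b3 := block {3, 4, 0} (by decide)
    have b4 := block {4, 0, 1} (by decide)
    have b5 := block {5, 0, 2} (by decide)
    have b6 := block {5, 1, 3} (by decide)
    have b7 := block {5, 2, 4} (by decide)
    have b8 := block {5, 3, 0} (by decide)
    have b9 := block {5, 4, 1} (by decide)
    generalize (fun t => (Finset.univ.filter fun x => φ x = t).card) = w at *
    simp only [Fin.sum_univ_six] at htot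
    simp at b0 b1 b2 b3 b4 b5 b6 b7 b8 b9
    split_ifs <;> omega
  · have hind_part : ∀ q : V → Prop, (∀ x y, q x → q y → ¬ Γ.Adj x y) →
        ∀ x y z, (q x ∨ x = v) → (q y ∨ y = v) → (q z ∨ z = v) →
          ¬ (Γ.Adj x y ↔ (Γ.Adj y z ↔ Γ.Adj x z)) := by
      intro q hq x y z hx hy hz
      have hno : ∀ x y, (q x ∨ x = v) → (q y ∨ y = v) → ¬ Γ.Adj x y := by
        rintro x y (hx | rfl) (hy | rfl)
        exacts [hq x y hx hy, hv' x, hv y, hv _]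
      simp [hno x y hx hy, hno y z hy hz, hno x z hx hz]
    classical
    have hA := hclique (Finset.univ.filter fun x => p x ∨ x = v) (by
      simp only [Finset.mem_filter, Finset.mem_univ, true_and]
      intro x hx y hy z hz
      exact hind_part p (fun x y hx hy h => (hp x y h).1 hx hy) x y z hx hy hz)
    have hB := hclique (Finset.univ.filter fun x => ¬ p x ∨ x = v) (by
      simp only [Finset.mem_filter, Finset.mem_univ, true_and]
      intro x hx y hy z hz
      exact hind_part (fun x => ¬ p x) (fun x y hx hy h => hx ((hp x y h).2 hy)) x y z hx hy hz)
    have hunion := Finset.card_union_add_card_inter (Finset.univ.filter fun x => p x ∨ x = v)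
      (Finset.univ.filter fun x => ¬ p x ∨ x = v)
    have h₁ : (Finset.univ.filter fun x => p x ∨ x = v) ∪
        (Finset.univ.filter fun x => ¬ p x ∨ x = v) = Finset.univ := by
      ext x; simp; tauto
    have h₂ : (Finset.univ.filter fun x => p x ∨ x = v) ∩
        (Finset.univ.filter fun x => ¬ p x ∨ x = v) = {v} := by
      ext x; simp; tauto
    rw [h₁, h₂, Finset.card_univ, Finset.card_singleton] at hunion
    split_ifs <;> omega

end LowerBound

end RGraph
theorem theorem1p5 (n : ℕ) (hn : 4 ≤ n) :
    minHomNumber 3 n {(4, 0), (4, 2), (4, 3)} = n - 1 ∧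
    minHomNumber 3 n {(4, 0), (4, 1), (4, 3)} =
      if n ≡ 0 [MOD 6] then n / 2 else ⌈((n : ℚ) + 1) / 2⌉₊ := by
  have hcard := Fintype.card_fin n
  constructor
  · refine RGraph.minHomNumber_eq
      ⟨RGraph.completeAvoiding ⟨0, by omega⟩, RGraph.completeAvoiding_isFree _, ?_⟩ ?_
    · exact (RGraph.completeAvoiding_homNumber_le _ (by omega)).trans (by omega)
    · intro H hH
      have := RGraph.le_homNumber_of_isFree_star (by omega) H hH
      omega
  · have hM : (if n ≡ 0 [MOD 6] then n / 2 else ⌈((n : ℚ) + 1) / 2⌉₊) =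
        if n % 6 = 0 then n / 2 else n / 2 + 1 := by
      have hmod : n ≡ 0 [MOD 6] ↔ n % 6 = 0 := by simp [Nat.ModEq]
      -- Valid for both parities, `n / 2` on the right being floor division.
      have hceil : ⌈((n : ℚ) + 1) / 2⌉₊ = n / 2 + 1 := by
        rw [Nat.ceil_eq_iff (by omega)]
        have h1 : 2 * (n / 2) ≤ n := by omega
        have h2 : n ≤ 2 * (n / 2) + 1 := by omega
        have h1 : 2 * ((n / 2 : ℕ) : ℚ) ≤ n := by exact_mod_cast h1
        have h2 : (n : ℚ) ≤ 2 * ((n / 2 : ℕ) : ℚ) + 1 := by exact_mod_cast h2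
        constructor
        · push_cast [Nat.add_sub_cancel]
          linarith
        · push_cast
          linarith
      simp only [hmod, hceil]
    rw [hM]
    refine RGraph.minHomNumber_eq (RGraph.exists_isFree_homNumber_le n hn) fun H hH => ?_
    have : Nonempty (Fin n) := ⟨⟨0, by omega⟩⟩
    simpa only [hcard] using RGraph.le_homNumber_of_isFree_even H hH
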